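/- Fix an inner product on $\mathbb{R}^n$ and let $\Phi\subset\mathbb{R}^n$ be a (reduced) root system: a finite set of nonzero vectors, not necessarily crystallographic or spanning, such that $\Phi\cap\mathbb{R}\alpha=\{\pm\alpha\}$ and $s_\alpha(\Phi)=\Phi$ for every $\alpha\in\Phi$, where $s_\alpha$ is the orthogonal reflection in the hyperplane $\alpha^\perp$. Let $\Delta\subset\Phi$ be a simple system, i.e. a linearly independent subset such that every root is a linear combination of elements of $\Delta$ with coefficients all $\ge 0$ or all $\le 0$. Let $W$ be the finite reflection group generated by $\{s_\gamma:\gamma\in\Phi\}$, and for a subset $\Theta\subset\Delta$ let $W_\Theta\subset W$ be the parabolic subgroup generated by $\{s_\gamma:\gamma\in\Theta\}$. Let $S=\mathrm{Sym}(\mathbb{R}^n)$ be the polynomial ring with $S^1=\mathbb{R}^n$, graded by degree, with the induced action of $W$. For $G=W$ or $G=W_\Theta$ let $S^G$ be the ring of $G$-invariants, let $(S^G)^+\subset S^G$ be the ideal generated by the homogeneous invariants of positive degree, and let $S_G=S/\bigl((S^G)^+\cdot S\bigr)$ be the coinvariant ring, with the induced grading. The group $W$ acts on $S_W$; let $S_W^{W_\Theta}\subset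 S_W$ be the graded subring of $W_\Theta$-invariants (the relative coinvariants), let $(S_W^{W_\Theta})^+$ be its ideal generated by the homogeneous elements of positive degree, and let $\pi\colon S_W^{W_\Theta}\to S_W$ be the inclusion. Since $(S^W)^+\cdot S\subseteq (S^{W_\Theta})^+\cdot S$, the identity of $S$ induces a ring homomorphism $\iota\colon S_W\to S_{W_\Theta}$. Then: 1. $\pi$ makes $S_W$ a free $S_W^{W_\Theta}$-module of finite rank $|W_\Theta|=\dim_{\mathbb{R}}(S_{W_\Theta})$. 2. $\iota$ is surjective with kernel $(S_W^{W_\Theta})^+\cdot S_W$. -/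

import Mathlib

namespace Coinv

noncomputable section

section Reflections

variable {E : Type*} [NormedAddCommGroup E] [InnerProductSpace ℝ E]

/-- The orthogonal reflection `s_γ` of a Euclidean space in the hyperplane `γ^⊥`. -/
def refl (γ : E) : E ≃ₗᵢ[ℝ] E := (Submodule.span ℝ {γ})ᗮ.reflection

/-- The usual formula for `s_γ`. -/
theorem refl_apply (γ x : E) :
    refl γ x = x - (2 * inner ℝ x γ / inner ℝ γ γ) • γ := by
  rw [refl, Submodule.reflection_orthogonal_apply, Submodule.reflection_singleton_apply,
    real_inner_comm, real_inner_self_eq_norm_sq, neg_sub, mul_div_assoc, mul_smul, two_smul,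
    two_smul]
  rfl

/-- A (reduced, not necessarily crystallographic, not necessarily spanning) root system in a
Euclidean space. -/
structure IsRootSystem (Φ : Set E) : Prop where
  finite : Φ.Finite
  zero_notMem : (0 : E) ∉ Φ
  reduced : ∀ α ∈ Φ, ∀ c : ℝ, c • α ∈ Φ → c = 1 ∨ c = -1
  refl_mem : ∀ α ∈ Φ, ∀ β ∈ Φ, refl α β ∈ Φ

/-- `Δ` is a simple system in `Φ`: it is linearly independent, and every root is a linear
combination of elements of `Δ` whose coefficients are all nonnegative or all nonpositive. -/
structure IsSimpleSystem (Φ Δ : Set E) : Prop where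
  subset : Δ ⊆ Φ
  linearIndepOn : LinearIndepOn ℝ id Δ
  mem_or_neg_mem : ∀ β ∈ Φ,
    β ∈ Submodule.span NNReal Δ ∨ -β ∈ Submodule.span NNReal Δ

/-- The group generated by the reflections in the elements of `A`. -/
def reflectionGroup (A : Set E) : Subgroup (E ≃ₗᵢ[ℝ] E) := Subgroup.closure (refl '' A)

theorem reflectionGroup_mono {A B : Set E} (h : A ⊆ B) :
    reflectionGroup A ≤ reflectionGroup B :=
  Subgroup.closure_mono (Set.image_mono h)

end Reflections

section Positive

variable {R : Type*} [CommRing R] [Algebra ℝ R]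

/-- For a ring `R` with homogeneous components `𝒢 i` and a subring `A`, the ideal `A⁺` of `A`
generated by the homogeneous elements of `A` of positive degree. -/
def positiveIdeal (𝒢 : ℕ → Submodule ℝ R) (A : Subalgebra ℝ R) : Ideal A :=
  Ideal.span {a | ∃ i : ℕ, 0 < i ∧ (a : R) ∈ 𝒢 i}

end Positive

section Coinvariants

variable {E : Type*} [NormedAddCommGroup E] [InnerProductSpace ℝ E]

/-- The degree `i` component `S^i` of `S = Sym(E)`, spanned by the `i`-fold products of
elements of `S^1 = E`. -/
def symDegree (E : Type*) [NormedAddCommGroup E] [InnerProductSpace ℝ E] (i : ℕ) :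
    Submodule ℝ (SymmetricAlgebra ℝ E) :=
  (LinearMap.range (SymmetricAlgebra.ι ℝ E)) ^ i

/-- The action of an isometry `g` of `E` on `S = Sym(E)` by algebra homomorphisms. -/
def symAct (g : E ≃ₗᵢ[ℝ] E) : SymmetricAlgebra ℝ E →ₐ[ℝ] SymmetricAlgebra ℝ E :=
  SymmetricAlgebra.lift (SymmetricAlgebra.ι ℝ E ∘ₗ g.toLinearEquiv.toLinearMap)

/-- The invariant ring `S^G`. -/
def invariants (G : Subgroup (E ≃ₗᵢ[ℝ] E)) : Subalgebra ℝ (SymmetricAlgebra ℝ E) where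
  carrier := {f | ∀ g ∈ G, symAct g f = f}
  mul_mem' ha hb g hg := by rw [map_mul, ha g hg, hb g hg]
  add_mem' ha hb g hg := by rw [map_add, ha g hg, hb g hg]
  algebraMap_mem' r g _ := (symAct g).commutes r

/-- The ideal `I = (S^G)⁺ · S` of `S`. -/
def coinvariantIdeal (G : Subgroup (E ≃ₗᵢ[ℝ] E)) : Ideal (SymmetricAlgebra ℝ E) :=
  (positiveIdeal (symDegree E) (invariants G)).map (invariants G).val

/-- The coinvariant ring `S_G = S / (S^G)⁺ · S`. -/
abbrev CoinvariantRing (G : Subgroup (E ≃ₗᵢ[ℝ] E)) : Type _ :=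
  SymmetricAlgebra ℝ E ⧸ coinvariantIdeal G

/-- The degree `i` component of `S_G`, the image of `S^i`. -/
def coinvariantDegree (G : Subgroup (E ≃ₗᵢ[ℝ] E)) (i : ℕ) :
    Submodule ℝ (CoinvariantRing G) :=
  (symDegree E i).map (Ideal.Quotient.mkₐ ℝ (coinvariantIdeal G)).toLinearMap

theorem coinvariantIdeal_eq_span (G : Subgroup (E ≃ₗᵢ[ℝ] E)) :
    coinvariantIdeal G =
      Ideal.span {f | f ∈ invariants G ∧ ∃ i : ℕ, 0 < i ∧ f ∈ symDegree E i} := by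
  rw [coinvariantIdeal, positiveIdeal, Ideal.map_span]
  congr 1
  ext f
  constructor
  · rintro ⟨a, ha, rfl⟩
    exact ⟨a.2, ha⟩
  · rintro ⟨hf, h⟩
    exact ⟨⟨f, hf⟩, h, rfl⟩

theorem coinvariantIdeal_le_comap (G : Subgroup (E ≃ₗᵢ[ℝ] E)) {g : E ≃ₗᵢ[ℝ] E} (hg : g ∈ G) :
    coinvariantIdeal G ≤ (coinvariantIdeal G).comap (symAct g) := by
  conv_lhs => rw [coinvariantIdeal_eq_span]
  rw [Ideal.span_le]
  rintro f ⟨hf, h⟩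
  change symAct g f ∈ coinvariantIdeal G
  rw [hf g hg, coinvariantIdeal_eq_span]
  exact Ideal.subset_span ⟨hf, h⟩

theorem coinvariantIdeal_mono {H G : Subgroup (E ≃ₗᵢ[ℝ] E)} (h : H ≤ G) :
    coinvariantIdeal G ≤ coinvariantIdeal H := by
  rw [coinvariantIdeal_eq_span, coinvariantIdeal_eq_span]
  exact Ideal.span_mono fun f hf => ⟨fun g hg => hf.1 g (h hg), hf.2⟩

/-- The action of `G` on `S_G` induced by its action on `S`. -/
def coinvariantAct (G : Subgroup (E ≃ₗᵢ[ℝ] E)) (g : G) :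
    CoinvariantRing G →ₐ[ℝ] CoinvariantRing G :=
  Ideal.quotientMapₐ (coinvariantIdeal G) (symAct (g : E ≃ₗᵢ[ℝ] E))
    (coinvariantIdeal_le_comap G g.2)

/-- For `H ≤ G`, the ring `S_G^H` of relative coinvariants: the subring of `H`-invariants
in `S_G`. -/
def relCoinvariants {H G : Subgroup (E ≃ₗᵢ[ℝ] E)} (h : H ≤ G) :
    Subalgebra ℝ (CoinvariantRing G) where
  carrier := {x | ∀ w : H, coinvariantAct G ⟨w, h w.2⟩ x = x}
  mul_mem' ha hb w := by rw [map_mul, ha w, hb w]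
  add_mem' ha hb w := by rw [map_add, ha w, hb w]
  algebraMap_mem' r w := (coinvariantAct G ⟨w, h w.2⟩).commutes r

/-- For `H ≤ G`, the natural map `S_G → S_H` induced by the identity of `S`. -/
def coinvariantMap {H G : Subgroup (E ≃ₗᵢ[ℝ] E)} (h : H ≤ G) :
    CoinvariantRing G →ₐ[ℝ] CoinvariantRing H :=
  Ideal.Quotient.factorₐ ℝ (coinvariantIdeal_mono h)

end Coinvariants

end

end Coinv

/-!
Write `S = Sym(E)`, `R = S^H` for a finite group `H` of isometries, and `m = R⁺`, so that the
coinvariant ring is `S_H = S / mS`.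

Everything rests on Chevalley's theorem that `S` is free over `R` when `H` is generated by
reflections, with homogeneous representatives of a basis of `S_H` as a basis
(`exists_basis_invariants`). That such representatives generate is the graded Nakayama lemma
(`span_eq_top_of_mk`). For their independence, suppose `∑ uᵢ zᵢ = 0` is a nontrivial relation, and
let `e` be the least degree in which some `uᵢ` has a nonzero component. Let `𝔞` be the ideal of
invariants which vanish to order `e` and whose component of degree `e` lies in a suitable
hyperplane. Modulo `𝔞` all the `uᵢ` are real multiples `cᵢ u` of one of them, and `m u ⊆ 𝔞`. So
`p = ∑ cᵢ zᵢ`, which is not in `mS`, satisfies `u p ∈ 𝔞 S`. This is impossible by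
`mem_coinvariantIdeal_of_mul_mem`: the divided differences `(f - s_γ f) / γ` are `R`-linear and
lower the degree, so by induction they map `p` into `mS`; hence `p` is congruent modulo `mS` to its
average over `H`, so to a constant `c`, and then `c u ∈ 𝔞 S ∩ R = 𝔞` forces `c = 0`.

The rank of `S` over `R` is `|H|` by Galois theory of the fraction fields (`card_eq_of_basis`), and
by construction it is also `dim S_H`.

Now let `H ≤ G`. Averaging over `H` shows that the `H`-invariants of `S_G` are the image of `R`.
Hence the kernel of `S_G → S_H` is generated by the relative coinvariants of positive degree
(`ker_coinvariantMap`). The ideal `(S^G)⁺ S` is generated by elements of `R`, so it is compatible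
with coordinates over `R`, and an `R`-basis of `S` reduces to a basis of `S_G` over its
`H`-invariants (`nonempty_basis_relCoinvariants`).
-/

namespace Coinv

noncomputable section

open DirectSum

/-! ### The grading of the symmetric algebra -/

section Grading

variable {E : Type*} [NormedAddCommGroup E] [InnerProductSpace ℝ E]

theorem ι_mem_symDegree (x : E) : SymmetricAlgebra.ι ℝ E x ∈ symDegree E 1 := by
  simp [symDegree]

instance symDegree_gradedMonoid : SetLike.GradedMonoid (symDegree E) :=
  inferInstanceAs (SetLike.GradedMonoid ((LinearMap.range (SymmetricAlgebra.ι ℝ E)) ^ · :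
    ℕ → Submodule ℝ (SymmetricAlgebra ℝ E)))

/-- The inclusion of `E` into the direct sum of the homogeneous components of `Sym(E)`. -/
def gradedι (E : Type*) [NormedAddCommGroup E] [InnerProductSpace ℝ E] :
    E →ₗ[ℝ] ⨁ i : ℕ, symDegree E i :=
  DirectSum.lof ℝ ℕ (fun i => symDegree E i) 1 ∘ₗ
    (SymmetricAlgebra.ι ℝ E).codRestrict _ ι_mem_symDegree

theorem gradedι_apply (x : E) :
    gradedι E x = DirectSum.of (fun i : ℕ => symDegree E i) 1
      ⟨SymmetricAlgebra.ι ℝ E x, ι_mem_symDegree x⟩ := rfl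

instance symGradedAlgebra : GradedAlgebra (symDegree E) :=
  GradedAlgebra.ofAlgHom _ (SymmetricAlgebra.lift (gradedι E))
    (by
      ext m
      simp [gradedι_apply])
    (fun i x => by
      obtain ⟨x, hx⟩ := x
      dsimp only [Subtype.coe_mk, DirectSum.lof_eq_of]
      induction hx using Submodule.pow_induction_on_left' with
      | algebraMap r =>
        rw [AlgHom.commutes, DirectSum.algebraMap_apply]; rfl
      | add x y i hx hy ihx ihy =>
        rw [map_add, ihx, ihy, ← map_add]
        rfl
      | mem_mul m hm i x hx ih =>
        obtain ⟨_, rfl⟩ := hm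
        rw [map_mul, ih, SymmetricAlgebra.lift_ι_apply, gradedι_apply, DirectSum.of_mul_of]
        exact DirectSum.of_eq_of_gradedMonoid_eq (Sigma.subtype_ext (add_comm _ _) rfl))

/-- The projection of `Sym(E)` onto its homogeneous component of degree `i`. -/
abbrev symProj (i : ℕ) : SymmetricAlgebra ℝ E →ₗ[ℝ] SymmetricAlgebra ℝ E :=
  GradedAlgebra.proj (symDegree E) i

theorem symProj_mem (i : ℕ) (f : SymmetricAlgebra ℝ E) : symProj i f ∈ symDegree E i :=
  (DirectSum.decompose (symDegree E) f i).2

theorem symProj_of_mem {i : ℕ} {f : SymmetricAlgebra ℝ E} (hf : f ∈ symDegree E i) :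
    symProj i f = f :=
  DirectSum.decompose_of_mem_same _ hf

theorem symProj_of_mem_ne {i j : ℕ} {f : SymmetricAlgebra ℝ E} (hf : f ∈ symDegree E i)
    (hij : i ≠ j) : symProj j f = 0 :=
  DirectSum.decompose_of_mem_ne _ hf hij

theorem symProj_mul_of_le {i n : ℕ} {f : SymmetricAlgebra ℝ E} (hf : f ∈ symDegree E i)
    (g : SymmetricAlgebra ℝ E) (h : i ≤ n) : symProj n (f * g) = f * symProj (n - i) g :=
  DirectSum.coe_decompose_mul_of_left_mem_of_le _ hf h

theorem symProj_mul_of_lt {i n : ℕ} {f : SymmetricAlgebra ℝ E} (hf : f ∈ symDegree E i)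
    (g : SymmetricAlgebra ℝ E) (h : n < i) : symProj n (f * g) = 0 :=
  DirectSum.coe_decompose_mul_of_left_mem_of_not_le _ hf (not_le.mpr h)

/-- Every polynomial has bounded degree. -/
theorem exists_symProj_eq_zero (f : SymmetricAlgebra ℝ E) :
    ∃ n, ∀ i, n ≤ i → symProj i f = 0 := by
  induction f using DirectSum.Decomposition.inductionOn (symDegree E) with
  | zero => exact ⟨0, fun i _ => map_zero _⟩
  | @homogeneous i m => exact ⟨i + 1, fun j hj => symProj_of_mem_ne m.2 (by omega)⟩
  | add f g hf hg =>
    obtain ⟨n, hn⟩ := hf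
    obtain ⟨k, hk⟩ := hg
    exact ⟨max n k, fun i hi => by
      rw [map_add, hn i (by omega), hk i (by omega), add_zero]⟩

theorem eq_zero_of_symProj_eq_zero {f : SymmetricAlgebra ℝ E} (h : ∀ i, symProj i f = 0) :
    f = 0 := by
  apply (DirectSum.decompose (symDegree E)).injective
  ext i
  rw [DirectSum.decompose_zero]
  exact h i

/-- To show that `f` lies in a submodule it suffices to treat its homogeneous components. -/
theorem mem_of_symProj_mem {N : Submodule ℝ (SymmetricAlgebra ℝ E)} {f : SymmetricAlgebra ℝ E}
    (h : ∀ i, symProj i f ∈ N) : f ∈ N := by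
  classical
  rw [← DirectSum.sum_support_decompose (symDegree E) f]
  exact N.sum_mem fun i _ => h i

theorem mem_symDegree_zero {f : SymmetricAlgebra ℝ E} :
    f ∈ symDegree E 0 ↔ ∃ c : ℝ, algebraMap ℝ _ c = f := by
  rw [symDegree, pow_zero, Submodule.mem_one]

end Grading

/-! ### The action of isometries -/

section Action

variable {E : Type*} [NormedAddCommGroup E] [InnerProductSpace ℝ E]

@[simp]
theorem symAct_ι (g : E ≃ₗᵢ[ℝ] E) (x : E) :
    symAct g (SymmetricAlgebra.ι ℝ E x) = SymmetricAlgebra.ι ℝ E (g x) := by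
  simp [symAct]

theorem symAct_one : symAct (1 : E ≃ₗᵢ[ℝ] E) = AlgHom.id ℝ _ := by
  ext x
  simp

theorem symAct_mul (g h : E ≃ₗᵢ[ℝ] E) : symAct (g * h) = (symAct g).comp (symAct h) := by
  ext x
  simp

theorem ι_injective : Function.Injective (SymmetricAlgebra.ι ℝ E) := by
  intro x y hxy
  -- A linear functional `f` on `E` extends to an algebra homomorphism `Sym(E) → ℝ`.
  rw [← sub_eq_zero, ← Module.forall_dual_apply_eq_zero_iff ℝ]
  intro f
  have := congrArg (SymmetricAlgebra.lift f) hxy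
  simpa [sub_eq_zero] using this

theorem symAct_injective : Function.Injective (symAct : (E ≃ₗᵢ[ℝ] E) → _) := by
  intro g h hgh
  ext x
  apply ι_injective
  rw [← symAct_ι, ← symAct_ι, hgh]

theorem symAct_mem_symDegree (g : E ≃ₗᵢ[ℝ] E) {i : ℕ} {f : SymmetricAlgebra ℝ E}
    (hf : f ∈ symDegree E i) : symAct g f ∈ symDegree E i := by
  have h : (symDegree E i).map (symAct g).toLinearMap ≤ symDegree E i := by
    rw [symDegree, Submodule.map_pow]
    refine pow_le_pow_left' ?_ i
    rintro _ ⟨_, ⟨x, rfl⟩, rfl⟩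
    exact ⟨g x, (symAct_ι g x).symm⟩
  exact h ⟨f, hf, rfl⟩

theorem symProj_symAct (g : E ≃ₗᵢ[ℝ] E) (i : ℕ) (f : SymmetricAlgebra ℝ E) :
    symProj i (symAct g f) = symAct g (symProj i f) := by
  induction f using DirectSum.Decomposition.inductionOn (symDegree E) with
  | zero => simp only [map_zero]
  | @homogeneous j m =>
    by_cases h : j = i
    · subst h
      rw [symProj_of_mem m.2, symProj_of_mem (symAct_mem_symDegree g m.2)]
    · rw [symProj_of_mem_ne m.2 h, symProj_of_mem_ne (symAct_mem_symDegree g m.2) h, map_zero]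
  | add f f' hf hf' => simp only [map_add, hf, hf']

theorem symProj_mem_invariants {G : Subgroup (E ≃ₗᵢ[ℝ] E)} (i : ℕ) {f : SymmetricAlgebra ℝ E}
    (hf : f ∈ invariants G) : symProj i f ∈ invariants G := fun g hg => by
  rw [← symProj_symAct, hf g hg]

end Action

/-! ### Divided differences -/

section DividedDifference

variable {E : Type*} [NormedAddCommGroup E] [InnerProductSpace ℝ E]

theorem ι_dvd_sub_symAct_refl (γ : E) (f : SymmetricAlgebra ℝ E) :
    SymmetricAlgebra.ι ℝ E γ ∣ f - symAct (refl γ) f := by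
  induction f using SymmetricAlgebra.induction with
  | algebraMap r => simp
  | ι x =>
    rw [symAct_ι, refl_apply, ← map_sub, sub_sub_cancel, map_smul, Algebra.smul_def]
    exact dvd_mul_left _ _
  | mul a b ha hb =>
    rw [map_mul, show a * b - symAct (refl γ) a * symAct (refl γ) b =
      a * (b - symAct (refl γ) b) + (a - symAct (refl γ) a) * symAct (refl γ) b by ring]
    exact dvd_add (hb.mul_left _) (ha.mul_right _)
  | add a b ha hb =>
    rw [map_add, add_sub_add_comm]
    exact dvd_add ha hb

/-- The divided difference operator `f ↦ (f - s_γ f) / γ`. It is linear over the invariants of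
every group containing `s_γ`. -/
theorem exists_dividedDifference {G : Subgroup (E ≃ₗᵢ[ℝ] E)} {γ : E} (hγ : γ ≠ 0)
    (hG : refl γ ∈ G) :
    ∃ D : SymmetricAlgebra ℝ E →ₗ[invariants G] SymmetricAlgebra ℝ E,
      ∀ f, SymmetricAlgebra.ι ℝ E γ * D f = f - symAct (refl γ) f := by
  choose D hD using ι_dvd_sub_symAct_refl γ
  have hι : SymmetricAlgebra.ι ℝ E γ ≠ 0 := fun h => hγ (ι_injective (h.trans (map_zero _).symm))
  refine ⟨⟨⟨D, fun f g => mul_left_cancel₀ hι ?_⟩, fun r f => mul_left_cancel₀ hι ?_⟩,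
    fun f => (hD f).symm⟩
  · rw [mul_add, ← hD, ← hD, ← hD, map_add, add_sub_add_comm]
  · simp only [RingHom.id_apply, Subalgebra.smul_def, smul_eq_mul]
    rw [← hD, mul_left_comm, ← hD, map_mul, r.2 _ hG, mul_sub]

/-- The divided difference operator lowers degrees. -/
theorem symProj_dividedDifference_eq_zero {γ : E} (hγ : γ ≠ 0) {f d : SymmetricAlgebra ℝ E}
    (hd : SymmetricAlgebra.ι ℝ E γ * d = f - symAct (refl γ) f) {i : ℕ}
    (hf : symProj (i + 1) f = 0) : symProj i d = 0 := by
  have h : symProj (i + 1) (SymmetricAlgebra.ι ℝ E γ * d) = 0 := by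
    rw [hd, map_sub, symProj_symAct, hf, map_zero, sub_zero]
  rw [symProj_mul_of_le (ι_mem_symDegree γ) d (by omega), add_tsub_cancel_right] at h
  exact (mul_eq_zero.mp h).resolve_left fun h => hγ (ι_injective (h.trans (map_zero _).symm))

end DividedDifference

/-! ### Averaging over a finite group -/

section Reynolds

variable {E : Type*} [NormedAddCommGroup E] [InnerProductSpace ℝ E]

theorem mem_map_val_iff {G : Subgroup (E ≃ₗᵢ[ℝ] E)} {𝔞 : Ideal (invariants G)}
    {x : SymmetricAlgebra ℝ E} :
    x ∈ 𝔞.map (invariants G).val ↔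
      x ∈ 𝔞 • (⊤ : Submodule (invariants G) (SymmetricAlgebra ℝ E)) := by
  rw [Ideal.smul_top_eq_map]
  rfl

theorem map_mem_smul_top {R M N : Type*} [CommRing R] [AddCommGroup M] [Module R M]
    [AddCommGroup N] [Module R N] {𝔞 : Ideal R} (φ : M →ₗ[R] N) {x : M}
    (hx : x ∈ 𝔞 • (⊤ : Submodule R M)) : φ x ∈ 𝔞 • (⊤ : Submodule R N) := by
  have h := Submodule.mem_map_of_mem (f := φ) hx
  rw [Submodule.map_smul''] at h
  exact Submodule.smul_mono le_rfl le_top h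

/-- The averaging operator `f ↦ |G|⁻¹ ∑ g f` of a finite group `G`. -/
def average (G : Subgroup (E ≃ₗᵢ[ℝ] E)) [Fintype G] (f : SymmetricAlgebra ℝ E) :
    SymmetricAlgebra ℝ E :=
  (Fintype.card G : ℝ)⁻¹ • ∑ g : G, symAct (g : E ≃ₗᵢ[ℝ] E) f

variable (G : Subgroup (E ≃ₗᵢ[ℝ] E)) [Fintype G]

theorem average_mem_invariants (f : SymmetricAlgebra ℝ E) : average G f ∈ invariants G := by
  intro g hg
  rw [average, map_smul, map_sum]
  congr 1
  refine Fintype.sum_equiv (Equiv.mulLeft (⟨g, hg⟩ : G)) _ _ fun h => ?_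
  simp [symAct_mul]

variable {G} in
theorem map_average_eq {M : Type*} [AddCommGroup M] [Module ℝ M]
    (φ : SymmetricAlgebra ℝ E →ₗ[ℝ] M) {f : SymmetricAlgebra ℝ E}
    (h : ∀ g ∈ G, φ (symAct g f) = φ f) : φ (average G f) = φ f := by
  have hc : (Fintype.card G : ℝ) ≠ 0 := Nat.cast_ne_zero.mpr Fintype.card_ne_zero
  rw [average, map_smul, map_sum, Finset.sum_congr rfl fun (g : G) _ => h g g.2, Finset.sum_const,
    Finset.card_univ, ← Nat.cast_smul_eq_nsmul ℝ, inv_smul_smul₀ hc]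

variable {G} in
theorem average_of_mem_invariants {f : SymmetricAlgebra ℝ E} (hf : f ∈ invariants G) :
    average G f = f :=
  map_average_eq (LinearMap.id (R := ℝ)) hf

theorem average_mem_symDegree {i : ℕ} {f : SymmetricAlgebra ℝ E} (hf : f ∈ symDegree E i) :
    average G f ∈ symDegree E i :=
  (symDegree E i).smul_mem _ ((symDegree E i).sum_mem fun (g : G) _ =>
    symAct_mem_symDegree (g : E ≃ₗᵢ[ℝ] E) hf)

/-- Averaging as a linear map over the ring of invariants. -/
def reynolds : SymmetricAlgebra ℝ E →ₗ[invariants G] invariants G where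
  toFun f := ⟨average G f, average_mem_invariants G f⟩
  map_add' f f' := by
    ext
    simp [average, Finset.sum_add_distrib]
  map_smul' r f := by
    ext
    simp only [average, Subalgebra.smul_def, smul_eq_mul, map_mul, RingHom.id_apply,
      Subalgebra.coe_mul]
    rw [mul_smul_comm, Finset.mul_sum]
    congr 1
    exact Finset.sum_congr rfl fun g _ => by rw [r.2 g g.2]

theorem reynolds_coe (r : invariants G) : reynolds G r = r :=
  Subtype.ext (average_of_mem_invariants r.2)

variable {G}

/-- Averaging shows that extension of ideals from the invariants to `Sym(E)` followed by
contraction gives nothing new. -/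
theorem mem_of_coe_mem_map {𝔞 : Ideal (invariants G)} {r : invariants G}
    (hr : (r : SymmetricAlgebra ℝ E) ∈ 𝔞.map (invariants G).val) : r ∈ 𝔞 := by
  have h := map_mem_smul_top (reynolds G) (mem_map_val_iff.mp hr)
  rwa [reynolds_coe, smul_eq_mul, Ideal.mul_top] at h

end Reynolds

/-! ### The coinvariant ideal -/

section CoinvariantIdeal

variable {E : Type*} [NormedAddCommGroup E] [InnerProductSpace ℝ E]
  {G : Subgroup (E ≃ₗᵢ[ℝ] E)}

theorem mem_coinvariantIdeal_of_mem {i : ℕ} (hi : 0 < i) {f : SymmetricAlgebra ℝ E}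
    (hf : f ∈ invariants G) (h : f ∈ symDegree E i) : f ∈ coinvariantIdeal G := by
  rw [coinvariantIdeal_eq_span]
  exact Ideal.subset_span ⟨hf, i, hi, h⟩

theorem exists_sub_algebraMap_mem_coinvariantIdeal {f : SymmetricAlgebra ℝ E}
    (hf : f ∈ invariants G) : ∃ c : ℝ, f - algebraMap ℝ _ c ∈ coinvariantIdeal G := by
  obtain ⟨c, hc⟩ := mem_symDegree_zero.mp (symProj_mem 0 f)
  refine ⟨c, mem_of_symProj_mem (N := (coinvariantIdeal G).restrictScalars ℝ) fun i => ?_⟩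
  rw [hc, map_sub]
  obtain rfl | hi := Nat.eq_zero_or_pos i
  · rw [symProj_of_mem (symProj_mem 0 f), sub_self]
    exact zero_mem _
  · rw [symProj_of_mem_ne (symProj_mem 0 f) hi.ne, sub_zero]
    exact mem_coinvariantIdeal_of_mem hi (symProj_mem_invariants i hf) (symProj_mem i f)

/-- The degree `d` component of an element of the coinvariant ideal is a combination of positive
degree invariants with coefficients of degree less than `d`. -/
theorem symProj_mem_span_of_mem_coinvariantIdeal
    {T : Submodule (invariants G) (SymmetricAlgebra ℝ E)} {d : ℕ}
    (hT : ∀ j < d, ∀ f ∈ symDegree E j, f ∈ T) {f : SymmetricAlgebra ℝ E}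
    (hf : f ∈ coinvariantIdeal G) : symProj d f ∈ T := by
  rw [coinvariantIdeal_eq_span, Ideal.span, Submodule.mem_span_set'] at hf
  obtain ⟨n, a, u, rfl⟩ := hf
  rw [map_sum]
  refine T.sum_mem fun k _ => ?_
  obtain ⟨hu, i, hi, hui⟩ := (u k).2
  rw [smul_eq_mul, mul_comm]
  obtain h | h := le_or_gt i d
  · rw [symProj_mul_of_le hui _ h]
    exact T.smul_mem ⟨_, hu⟩ (hT (d - i) (by omega) _ (symProj_mem _ _))
  · rw [symProj_mul_of_lt hui _ h]
    exact T.zero_mem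

end CoinvariantIdeal

/-! ### Freeness over the invariants of a reflection group -/

section Free

variable {E : Type*} [NormedAddCommGroup E] [InnerProductSpace ℝ E]

/-- If `f` is fixed modulo the coinvariant ideal by the generating reflections, then it is fixed
modulo this ideal by the whole group. -/
theorem symAct_sub_mem_of_refl {A : Set E} {G : Subgroup (E ≃ₗᵢ[ℝ] E)}
    (hG : G = reflectionGroup A) {f : SymmetricAlgebra ℝ E}
    (h : ∀ γ ∈ A, f - symAct (refl γ) f ∈ coinvariantIdeal G)
    {g : E ≃ₗᵢ[ℝ] E} (hg : g ∈ G) :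
    f - symAct g f ∈ coinvariantIdeal G := by
  have hact : ∀ g ∈ G, ∀ x ∈ coinvariantIdeal G,
      symAct g x ∈ coinvariantIdeal G := fun g hg x hx =>
    coinvariantIdeal_le_comap _ hg hx
  rw [hG] at hg
  induction hg using Subgroup.closure_induction with
  | mem x hx =>
    obtain ⟨γ, hγ, rfl⟩ := hx
    exact h γ hγ
  | one => simp [symAct_one]
  | mul x y hx hy ihx ihy =>
    rw [symAct_mul, AlgHom.comp_apply, show f - symAct x (symAct y f) =
      (f - symAct x f) + symAct x (f - symAct y f) by rw [map_sub]; ring]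
    exact add_mem ihx (hact x (hG ▸ hx) _ ihy)
  | inv x hx ihx =>
    have h := hact x⁻¹ (hG ▸ inv_mem hx) _ ihx
    rw [map_sub, ← AlgHom.comp_apply, ← symAct_mul, inv_mul_cancel, symAct_one, AlgHom.id_apply,
      ← neg_mem_iff, neg_sub] at h
    exact h

/-- Chevalley's lemma. Let `u` be an invariant that spans a copy of the trivial module `ℝ` modulo
an ideal `𝔞` of invariants. Then multiplication by `u` embeds the coinvariant ring into
`S / 𝔞 S`. The proof is by induction on a bound `n` for the degree of `p`: divided differences
lower the degree and are linear over invariants, so they map `p` into the coinvariant ideal;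
thus `p` is a constant modulo this ideal. -/
theorem mem_coinvariantIdeal_of_mul_mem {A : Set E} (hA : (0 : E) ∉ A)
    {G : Subgroup (E ≃ₗᵢ[ℝ] E)} (hG : G = reflectionGroup A) [Fintype G] {𝔞 : Ideal (invariants G)}
    {u : invariants G} (hu : u ∉ 𝔞)
    (hmu : ∀ r ∈ positiveIdeal (symDegree E) (invariants G), u * r ∈ 𝔞)
    (n : ℕ) {p : SymmetricAlgebra ℝ E} (hp : ∀ i, n ≤ i → symProj i p = 0)
    (hup : (u : SymmetricAlgebra ℝ E) * p ∈ 𝔞.map (invariants G).val) :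
    p ∈ coinvariantIdeal G := by
  induction n generalizing p with
  | zero =>
    rw [eq_zero_of_symProj_eq_zero fun i => hp i i.zero_le]
    exact zero_mem _
  | succ n ih =>
    have hrefl : ∀ γ ∈ A, p - symAct (refl γ) p ∈ coinvariantIdeal G := by
      intro γ hγ
      have hγ0 : γ ≠ 0 := ne_of_mem_of_not_mem hγ hA
      obtain ⟨D, hD⟩ := exists_dividedDifference (G := G) hγ0
        (hG ▸ Subgroup.subset_closure ⟨γ, hγ, rfl⟩)
      rw [← hD]
      refine Ideal.mul_mem_left _ _ (ih (fun i hi => ?_) ?_)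
      · exact symProj_dividedDifference_eq_zero hγ0 (hD p) (hp _ (by omega))
      · have h := map_mem_smul_top D (mem_map_val_iff.mp hup)
        rw [← smul_eq_mul, ← Subalgebra.smul_def, map_smul] at h
        exact mem_map_val_iff.mpr h
    have havg : p - average G p ∈ coinvariantIdeal G := by
      rw [← Ideal.Quotient.eq]
      refine (map_average_eq (Ideal.Quotient.mkₐ ℝ (coinvariantIdeal G)).toLinearMap
        fun g hg => ?_).symm
      exact (Ideal.Quotient.eq.mpr (symAct_sub_mem_of_refl hG hrefl hg)).symm
    obtain ⟨c, hc⟩ := exists_sub_algebraMap_mem_coinvariantIdeal (average_mem_invariants G p)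
    have hpc : p - algebraMap ℝ _ c ∈ coinvariantIdeal G := by
      simpa using add_mem havg hc
    have huJ : ∀ x ∈ coinvariantIdeal G,
        (u : SymmetricAlgebra ℝ E) * x ∈ 𝔞.map (invariants G).val := by
      intro x hx
      have h : (u : SymmetricAlgebra ℝ E) * x ∈
          (Ideal.span {u} * positiveIdeal (symDegree E) (invariants G)).map (invariants G).val := by
        rw [Ideal.map_mul]
        exact Ideal.mul_mem_mul (Ideal.mem_map_of_mem _ (Ideal.mem_span_singleton_self u)) hx
      have hle : Ideal.span {u} * positiveIdeal (symDegree E) (invariants G) ≤ 𝔞 :=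
        Ideal.span_singleton_mul_le_iff.mpr hmu
      exact Ideal.map_mono (f := (invariants G).val) hle h
    have huc : c • u ∈ 𝔞 := by
      apply mem_of_coe_mem_map
      have h := sub_mem hup (huJ _ hpc)
      rw [← mul_sub, sub_sub_cancel, mul_comm, ← Algebra.smul_def] at h
      exact h
    have hc0 : c = 0 := by
      by_contra hc0
      refine hu ?_
      have h := 𝔞.mul_mem_left (algebraMap ℝ _ c⁻¹) huc
      rwa [← Algebra.smul_def, inv_smul_smul₀ hc0] at h
    simpa [hc0] using hpc

theorem symProj_mul_eq_zero_of_pos {i e : ℕ} (hi : 0 < i) {r f : SymmetricAlgebra ℝ E}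
    (hr : r ∈ symDegree E i) (hf : ∀ j < e, symProj j f = 0) {j : ℕ} (hj : j ≤ e) :
    symProj j (r * f) = 0 := by
  obtain h | h := le_or_gt i j
  · rw [symProj_mul_of_le hr f h, hf _ (by omega), mul_zero]
  · exact symProj_mul_of_lt hr f h

/-- The ideal of all polynomials that vanish to order `e` at the origin and whose component of
degree `e` lies in the hyperplane `lam = 0`. -/
def initialIdeal (e : ℕ) (lam : Module.Dual ℝ (SymmetricAlgebra ℝ E)) :
    Ideal (SymmetricAlgebra ℝ E) where
  carrier := {f | (∀ j < e, symProj j f = 0) ∧ lam (symProj e f) = 0}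
  zero_mem' := ⟨fun j _ => map_zero _, by rw [map_zero, map_zero]⟩
  add_mem' := fun {a b} ha hb =>
    ⟨fun j hj => by rw [map_add, ha.1 j hj, hb.1 j hj, add_zero],
      by rw [map_add, map_add, ha.2, hb.2, add_zero]⟩
  smul_mem' := fun r f hf => by
    rw [smul_eq_mul]
    induction r using DirectSum.Decomposition.inductionOn (symDegree E) with
    | zero =>
      rw [zero_mul]
      exact ⟨fun j _ => map_zero _, by rw [map_zero, map_zero]⟩
    | @homogeneous i m =>
      obtain rfl | hi := Nat.eq_zero_or_pos i
      · obtain ⟨c, hc⟩ := mem_symDegree_zero.mp m.2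
        rw [← hc, ← Algebra.smul_def]
        exact ⟨fun j hj => by rw [map_smul, hf.1 j hj, smul_zero],
          by rw [map_smul, map_smul, hf.2, smul_zero]⟩
      · exact ⟨fun j hj => symProj_mul_eq_zero_of_pos hi m.2 hf.1 hj.le,
          by rw [symProj_mul_eq_zero_of_pos hi m.2 hf.1 le_rfl, map_zero]⟩
    | add a b ha hb =>
      rw [add_mul]
      exact ⟨fun j hj => by rw [map_add, ha.1 j hj, hb.1 j hj, add_zero],
        by rw [map_add, map_add, ha.2, hb.2, add_zero]⟩

/-- Representatives of linearly independent coinvariants of a reflection group are linearly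
independent over the invariants. -/
theorem linearIndependent_of_mk {A : Set E} (hA : (0 : E) ∉ A) {G : Subgroup (E ≃ₗᵢ[ℝ] E)}
    (hG : G = reflectionGroup A) [Fintype G]
    {I : Type*} {z : I → SymmetricAlgebra ℝ E}
    (hz : LinearIndependent ℝ
      fun i => Ideal.Quotient.mkₐ ℝ (coinvariantIdeal G) (z i)) :
    LinearIndependent (invariants G) z := by
  classical
  rw [linearIndependent_iff']
  intro s u hsum
  by_contra! hne
  obtain ⟨i₁, hi₁, hne⟩ := hne
  -- `e` is the least degree in which some coefficient has a nonzero component.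
  have hex : ∃ e, ∃ i ∈ s, symProj e (u i : SymmetricAlgebra ℝ E) ≠ 0 := by
    by_contra! h
    exact hne (Subtype.ext (eq_zero_of_symProj_eq_zero fun e => h e i₁ hi₁))
  set e := Nat.find hex
  obtain ⟨i₀, hi₀, hi₀e⟩ := Nat.find_spec hex
  have hlt : ∀ i ∈ s, ∀ j < e, symProj j (u i : SymmetricAlgebra ℝ E) = 0 := by
    intro i hi j hj
    by_contra h
    exact Nat.find_min hex hj ⟨i, hi, h⟩
  obtain ⟨lam, hlam⟩ : ∃ lam : Module.Dual ℝ (SymmetricAlgebra ℝ E),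
      lam (symProj e (u i₀ : SymmetricAlgebra ℝ E)) ≠ 0 := by
    by_contra! h
    exact hi₀e ((Module.forall_dual_apply_eq_zero_iff ℝ _).mp h)
  let 𝔞 : Ideal (invariants G) := (initialIdeal e lam).comap (invariants G).val
  set v := u i₀
  set c : I → ℝ := fun i => lam (symProj e (u i : SymmetricAlgebra ℝ E)) /
    lam (symProj e (v : SymmetricAlgebra ℝ E)) with hc
  have huc : ∀ i ∈ s, u i - c i • v ∈ 𝔞 := by
    intro i hi
    refine ⟨fun j hj => ?_, ?_⟩
    · have : symProj j ((u i : SymmetricAlgebra ℝ E) - c i • (v : SymmetricAlgebra ℝ E)) = 0 := by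
        rw [map_sub, map_smul, hlt i hi j hj, hlt i₀ hi₀ j hj, smul_zero, sub_zero]
      exact this
    · have : lam (symProj e ((u i : SymmetricAlgebra ℝ E) - c i • (v : SymmetricAlgebra ℝ E)))
        = 0 := by
        simp only [map_sub, map_smul, smul_eq_mul, hc, div_mul_cancel₀ _ hlam, sub_self]
      exact this
  have hv𝔞 : v ∉ 𝔞 := fun h => hlam h.2
  have hmv : ∀ r ∈ positiveIdeal (symDegree E) (invariants G), v * r ∈ 𝔞 := by
    intro r hr
    induction hr using Submodule.span_induction with
    | mem r hr =>
      obtain ⟨i, hi, hri⟩ := hr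
      rw [mul_comm]
      exact ⟨fun j hj => symProj_mul_eq_zero_of_pos hi hri (hlt i₀ hi₀) hj.le,
        (congrArg lam (symProj_mul_eq_zero_of_pos hi hri (hlt i₀ hi₀) le_rfl)).trans
          (map_zero lam)⟩
    | zero =>
      rw [mul_zero]
      exact zero_mem _
    | add x y _ _ hx hy =>
      rw [mul_add]
      exact add_mem hx hy
    | smul a x _ hx =>
      rw [smul_eq_mul, mul_left_comm]
      exact 𝔞.mul_mem_left a hx
  have hmem : (v : SymmetricAlgebra ℝ E) * ∑ i ∈ s, c i • z i ∈ 𝔞.map (invariants G).val := by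
    have h : (v : SymmetricAlgebra ℝ E) * ∑ i ∈ s, c i • z i =
        - ∑ i ∈ s, z i * (invariants G).val (u i - c i • v) := by
      simp only [Subalgebra.smul_def, smul_eq_mul] at hsum
      rw [eq_neg_iff_add_eq_zero, Finset.mul_sum, ← Finset.sum_add_distrib, ← hsum]
      refine Finset.sum_congr rfl fun i _ => ?_
      simp only [map_sub, map_smul, Subalgebra.coe_val, mul_sub, mul_smul_comm]
      rw [mul_comm (v : SymmetricAlgebra ℝ E), add_sub_cancel, mul_comm]
    rw [h]
    exact neg_mem (sum_mem fun i hi => Ideal.mul_mem_left _ _ (Ideal.mem_map_of_mem _ (huc i hi)))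
  obtain ⟨n, hn⟩ := exists_symProj_eq_zero (∑ i ∈ s, c i • z i)
  have hJ := mem_coinvariantIdeal_of_mul_mem hA hG hv𝔞 hmv n hn hmem
  have hzero : ∑ i ∈ s, c i • Ideal.Quotient.mkₐ ℝ (coinvariantIdeal G) (z i) = 0 := by
    have : Ideal.Quotient.mkₐ ℝ (coinvariantIdeal G) (∑ i ∈ s, c i • z i) = 0 :=
      Ideal.Quotient.eq_zero_iff_mem.mpr hJ
    simpa only [map_sum, map_smul] using this
  have h0 := linearIndependent_iff'.mp hz s c hzero i₀ hi₀
  rw [hc] at h0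
  exact one_ne_zero ((div_self hlam).symm.trans h0)

/-- The graded version of Nakayama's lemma: homogeneous representatives of a spanning family of
coinvariants generate `Sym(E)` over the invariants. -/
theorem span_eq_top_of_mk {G : Subgroup (E ≃ₗᵢ[ℝ] E)} {I : Type*} {z : I → SymmetricAlgebra ℝ E}
    (hhom : ∀ i, ∃ d, z i ∈ symDegree E d)
    (hz : Submodule.span ℝ
      (Set.range fun i => Ideal.Quotient.mkₐ ℝ (coinvariantIdeal G) (z i)) = ⊤) :
    Submodule.span (invariants G) (Set.range z) = ⊤ := by
  set T := Submodule.span (invariants G) (Set.range z)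
  have hT : ∀ d, ∀ f ∈ symDegree E d, f ∈ T := by
    intro d
    induction d using Nat.strong_induction_on with
    | _ d ih =>
    intro f hf
    have hmem : Ideal.Quotient.mkₐ ℝ (coinvariantIdeal G) f ∈ Submodule.span ℝ
      (Set.range fun i => Ideal.Quotient.mkₐ ℝ (coinvariantIdeal G) (z i)) := hz ▸ trivial
    rw [Finsupp.mem_span_range_iff_exists_finsupp] at hmem
    obtain ⟨c, hc⟩ := hmem
    have hJ : f - c.sum (fun i a => a • z i) ∈ coinvariantIdeal G := by
      rw [← Ideal.Quotient.eq]
      change Ideal.Quotient.mkₐ ℝ (coinvariantIdeal G) f = Ideal.Quotient.mkₐ ℝ _ _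
      rw [← hc, map_finsuppSum]
      simp only [map_smul]
    have h := symProj_mem_span_of_mem_coinvariantIdeal ih hJ
    rw [map_sub, symProj_of_mem hf] at h
    refine (T.sub_mem_iff_left ?_).mp h
    rw [map_finsuppSum]
    refine T.sum_mem fun i _ => ?_
    change symProj d (c i • z i) ∈ T
    rw [map_smul]
    refine T.smul_of_tower_mem _ ?_
    obtain ⟨j, hj⟩ := hhom i
    by_cases hjd : j = d
    · subst hjd
      rw [symProj_of_mem hj]
      exact Submodule.subset_span ⟨i, rfl⟩
    · rw [symProj_of_mem_ne hj hjd]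
      exact T.zero_mem
  rw [Submodule.eq_top_iff']
  exact fun f => mem_of_symProj_mem (N := T.restrictScalars ℝ) fun i => hT i _ (symProj_mem i f)

/-- `Sym(E)` is free over the invariants of a finite reflection group, on homogeneous
representatives of a basis of the coinvariant ring. -/
theorem exists_basis_invariants {A : Set E} (hA : (0 : E) ∉ A) {G : Subgroup (E ≃ₗᵢ[ℝ] E)}
    (hG : G = reflectionGroup A) [Fintype G] :
    ∃ I : Set (CoinvariantRing G),
      Nonempty (Module.Basis I ℝ (CoinvariantRing G)) ∧
      Nonempty (Module.Basis I (invariants G) (SymmetricAlgebra ℝ E)) := by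
  let mk := Ideal.Quotient.mkₐ ℝ (coinvariantIdeal G)
  let s : Set (CoinvariantRing G) := {x | ∃ d, ∃ f ∈ symDegree E d, mk f = x}
  have hs : ⊤ ≤ Submodule.span ℝ s := by
    rintro x -
    obtain ⟨f, rfl⟩ := Ideal.Quotient.mk_surjective x
    exact mem_of_symProj_mem (N := (Submodule.span ℝ s).comap mk.toLinearMap) fun i =>
      Submodule.subset_span ⟨i, symProj i f, symProj_mem i f, rfl⟩
  let b := Module.Basis.ofSpan hs
  have hb : ∀ i, ∃ d, ∃ f ∈ symDegree E d, mk f = b i :=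
    fun i => Module.Basis.ofSpan_subset hs ⟨i, rfl⟩
  choose d z hzd hzb using hb
  refine ⟨_, ⟨b⟩, ⟨Module.Basis.mk (v := z) (linearIndependent_of_mk hA hG ?_)
    (span_eq_top_of_mk (fun i => ⟨d i, hzd i⟩) ?_).ge⟩⟩
  · change LinearIndependent ℝ fun i => mk (z i)
    simp only [hzb]
    exact b.linearIndependent
  · change Submodule.span ℝ (Set.range fun i => mk (z i)) = ⊤
    simp only [hzb]
    exact b.span_eq

end Free

/-! ### The rank over the invariants -/

section Rank

variable {E : Type*} [NormedAddCommGroup E] [InnerProductSpace ℝ E]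

/-- The action of a group of isometries on `Sym(E)` by ring automorphisms. -/
instance symMulSemiringAction (G : Subgroup (E ≃ₗᵢ[ℝ] E)) :
    MulSemiringAction G (SymmetricAlgebra ℝ E) where
  smul g f := symAct (g : E ≃ₗᵢ[ℝ] E) f
  one_smul f := congrArg (fun φ => φ f) symAct_one
  mul_smul g h f := congrArg (fun φ => φ f) (symAct_mul (g : E ≃ₗᵢ[ℝ] E) h)
  smul_zero _ := map_zero _
  smul_add _ := map_add _
  smul_one _ := map_one _
  smul_mul _ := map_mul _

theorem symSmul_def {G : Subgroup (E ≃ₗᵢ[ℝ] E)} (g : G) (f : SymmetricAlgebra ℝ E) :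
    g • f = symAct (g : E ≃ₗᵢ[ℝ] E) f := rfl

instance invariants_isGaloisGroup (G : Subgroup (E ≃ₗᵢ[ℝ] E)) :
    IsGaloisGroup G (invariants G) (SymmetricAlgebra ℝ E) where
  faithful := ⟨fun {g h} hgh => Subtype.ext (symAct_injective (AlgHom.ext hgh))⟩
  commutes := ⟨fun g r f => by
    simp only [Subalgebra.smul_def, smul_eq_mul, symSmul_def, map_mul]
    rw [r.2 g g.2]⟩
  isInvariant := ⟨fun f hf => ⟨⟨f, fun g hg => hf ⟨g, hg⟩⟩, rfl⟩⟩

theorem card_eq_of_basis {G : Subgroup (E ≃ₗᵢ[ℝ] E)} [Finite G] {I : Type*}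
    (b : Module.Basis I (invariants G) (SymmetricAlgebra ℝ E)) : Nat.card I = Nat.card G := by
  rw [IsGaloisGroup.card_eq_finrank' G (invariants G) (SymmetricAlgebra ℝ E),
    Module.finrank_eq_nat_card_basis b]

end Rank

/-! ### Relative coinvariants -/

section Relative

variable {E : Type*} [NormedAddCommGroup E] [InnerProductSpace ℝ E]
  {H G : Subgroup (E ≃ₗᵢ[ℝ] E)}

theorem mk_mem_relCoinvariants (h : H ≤ G) {f : SymmetricAlgebra ℝ E} (hf : f ∈ invariants H) :
    Ideal.Quotient.mkₐ ℝ (coinvariantIdeal G) f ∈ relCoinvariants h := fun w => by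
  change Ideal.Quotient.mkₐ ℝ (coinvariantIdeal G) (symAct (w : E ≃ₗᵢ[ℝ] E) f) = _
  rw [hf w w.2]

/-- In characteristic zero, invariant classes have invariant representatives. -/
theorem mk_average_eq (h : H ≤ G) [Fintype H] {f : SymmetricAlgebra ℝ E}
    (hf : Ideal.Quotient.mkₐ ℝ (coinvariantIdeal G) f ∈ relCoinvariants h) :
    Ideal.Quotient.mkₐ ℝ (coinvariantIdeal G) (average H f) =
      Ideal.Quotient.mkₐ ℝ (coinvariantIdeal G) f :=
  map_average_eq (Ideal.Quotient.mkₐ ℝ (coinvariantIdeal G)).toLinearMap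
    fun g hg => hf ⟨g, hg⟩

theorem exists_invariant_rep (h : H ≤ G) [Fintype H] (a : relCoinvariants h) :
    ∃ r : invariants H, Ideal.Quotient.mkₐ ℝ (coinvariantIdeal G) r = a := by
  obtain ⟨f, hf⟩ := Ideal.Quotient.mk_surjective (a : CoinvariantRing G)
  have hf' : Ideal.Quotient.mkₐ ℝ (coinvariantIdeal G) f = a := hf
  exact ⟨⟨_, average_mem_invariants H f⟩, (mk_average_eq h (hf' ▸ a.2)).trans hf'⟩

/-- `S^H`-linear maps respect the ideal `(S^G)⁺ S`, as it is generated by elements of `S^H`. -/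
theorem map_mem_coinvariantIdeal (h : H ≤ G)
    (φ : SymmetricAlgebra ℝ E →ₗ[invariants H] invariants H) {f : SymmetricAlgebra ℝ E}
    (hf : f ∈ coinvariantIdeal G) : (φ f : SymmetricAlgebra ℝ E) ∈ coinvariantIdeal G := by
  have hf' := hf
  rw [coinvariantIdeal_eq_span, Ideal.span, Submodule.mem_span_set'] at hf'
  obtain ⟨n, a, u, rfl⟩ := hf'
  rw [map_sum, AddSubmonoidClass.coe_finsetSum]
  refine sum_mem fun k _ => ?_
  obtain ⟨hu, i, hi, hui⟩ := (u k).2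
  have hmul : a k • (u k : SymmetricAlgebra ℝ E) =
      (⟨u k, fun g hg => hu g (h hg)⟩ : invariants H) • a k := mul_comm _ _
  rw [hmul, map_smul]
  exact Ideal.mul_mem_right _ _ (mem_coinvariantIdeal_of_mem hi hu hui)

/-- Freeness of `S` over `S^H` descends to freeness of `S_G` over its `H`-invariants, with the
same rank. -/
theorem nonempty_basis_relCoinvariants (h : H ≤ G) [Fintype H] {I : Type*}
    (b : Module.Basis I (invariants H) (SymmetricAlgebra ℝ E)) :
    Nonempty (Module.Basis I (relCoinvariants h) (CoinvariantRing G)) := by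
  let mk := Ideal.Quotient.mkₐ ℝ (coinvariantIdeal G)
  let toRel : invariants H → relCoinvariants h := fun r => ⟨mk r, mk_mem_relCoinvariants h r.2⟩
  have hsmul : ∀ (r : invariants H) f, mk (r • f) = toRel r • mk f := fun r f =>
    map_mul mk (r : SymmetricAlgebra ℝ E) f
  refine ⟨Module.Basis.mk (v := fun i => mk (b i)) ?_ ?_⟩
  · rw [linearIndependent_iff']
    intro s a hsum i hi
    choose r hr using exists_invariant_rep h
    have hmem : ∑ j ∈ s, r (a j) • b j ∈ coinvariantIdeal G := by
      rw [← Ideal.Quotient.eq_zero_iff_mem]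
      change mk _ = 0
      rw [map_sum, ← hsum]
      refine Finset.sum_congr rfl fun j _ => ?_
      rw [hsmul]
      congr 1
      exact Subtype.ext (hr (a j))
    have hcoord := map_mem_coinvariantIdeal h (b.coord i) hmem
    classical
    have hi' : b.coord i (∑ j ∈ s, r (a j) • b j) = r (a i) := by
      simp [Finsupp.single_apply, hi]
    rw [hi'] at hcoord
    exact Subtype.ext ((hr (a i)).symm.trans (Ideal.Quotient.eq_zero_iff_mem.mpr hcoord))
  · rintro x -
    obtain ⟨f, rfl⟩ := Ideal.Quotient.mk_surjective x
    change mk f ∈ _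
    rw [← b.linearCombination_repr f, Finsupp.linearCombination_apply, map_finsuppSum]
    refine Submodule.sum_mem _ fun i _ => ?_
    change mk (b.repr f i • b i) ∈ _
    rw [hsmul]
    exact Submodule.smul_mem _ _ (Submodule.subset_span ⟨i, rfl⟩)

theorem coinvariantMap_mk (h : H ≤ G) (f : SymmetricAlgebra ℝ E) :
    coinvariantMap h (Ideal.Quotient.mkₐ ℝ (coinvariantIdeal G) f) =
      Ideal.Quotient.mkₐ ℝ (coinvariantIdeal H) f := rfl

theorem coinvariantMap_surjective (h : H ≤ G) : Function.Surjective (coinvariantMap h) := by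
  intro x
  obtain ⟨f, rfl⟩ := Ideal.Quotient.mk_surjective x
  exact ⟨Ideal.Quotient.mkₐ ℝ _ f, rfl⟩

theorem ker_coinvariantMap (h : H ≤ G) [Fintype H] :
    RingHom.ker (coinvariantMap h) =
      (positiveIdeal (coinvariantDegree G) (relCoinvariants h)).map (relCoinvariants h).val := by
  apply le_antisymm
  · intro x hx
    obtain ⟨f, rfl⟩ := Ideal.Quotient.mk_surjective x
    have hf : f ∈ coinvariantIdeal H := Ideal.Quotient.eq_zero_iff_mem.mp hx
    have hle : coinvariantIdeal H ≤ ((positiveIdeal (coinvariantDegree G) (relCoinvariants h)).map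
        (relCoinvariants h).val).comap (Ideal.Quotient.mk (coinvariantIdeal G)) := by
      rw [coinvariantIdeal_eq_span, Ideal.span_le]
      rintro r ⟨hr, i, hi, hri⟩
      let a : relCoinvariants h := ⟨_, mk_mem_relCoinvariants h hr⟩
      have ha : a ∈ positiveIdeal (coinvariantDegree G) (relCoinvariants h) :=
        Ideal.subset_span ⟨i, hi, r, hri, rfl⟩
      exact Ideal.mem_map_of_mem (relCoinvariants h).val ha
    exact hle hf
  · rw [positiveIdeal, Ideal.map_span, Ideal.span_le]
    rintro _ ⟨a, ⟨i, hi, f, hf, hfa⟩, rfl⟩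
    have hfa' : Ideal.Quotient.mkₐ ℝ (coinvariantIdeal G) f = a := hfa
    change coinvariantMap h (a : CoinvariantRing G) = 0
    rw [← hfa', ← mk_average_eq h (hfa' ▸ a.2), coinvariantMap_mk]
    exact Ideal.Quotient.eq_zero_iff_mem.mpr (mem_coinvariantIdeal_of_mem hi
      (average_mem_invariants H f) (average_mem_symDegree H hf))

end Relative

/-! ### Finiteness of the reflection group of a root system -/

section Finite

variable {E : Type*} [NormedAddCommGroup E] [InnerProductSpace ℝ E]

theorem IsRootSystem.mem_of_mem_reflectionGroup {Φ : Set E} (hΦ : IsRootSystem Φ)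
    {g : E ≃ₗᵢ[ℝ] E} (hg : g ∈ reflectionGroup Φ) : ∀ β ∈ Φ, g β ∈ Φ := by
  have hrefl : ∀ γ : E, (refl γ)⁻¹ = refl γ := fun γ => Submodule.reflection_symm
  induction hg using Subgroup.closure_induction'' with
  | mem x hx =>
    obtain ⟨γ, hγ, rfl⟩ := hx
    exact hΦ.refl_mem γ hγ
  | inv_mem x hx =>
    obtain ⟨γ, hγ, rfl⟩ := hx
    rw [hrefl]
    exact hΦ.refl_mem γ hγ
  | one => exact fun β hβ => hβ
  | mul x y _ _ ihx ihy => exact fun β hβ => ihx _ (ihy β hβ)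

/-- Elements of a reflection group fix every vector orthogonal to all roots. -/
theorem apply_eq_of_mem_reflectionGroup {A : Set E} {g : E ≃ₗᵢ[ℝ] E}
    (hg : g ∈ reflectionGroup A) {x : E} (hx : x ∈ (Submodule.span ℝ A)ᗮ) : g x = x := by
  induction hg using Subgroup.closure_induction with
  | mem g hg =>
    obtain ⟨γ, hγ, rfl⟩ := hg
    have h : inner ℝ x γ = 0 := by
      rw [real_inner_comm]
      exact hx γ (Submodule.subset_span hγ)
    simp [refl_apply, h]
  | one => rfl
  | mul g h _ _ ihg ihh => rw [LinearIsometryEquiv.coe_mul, Function.comp_apply, ihh, ihg]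
  | inv g _ ih =>
    exact (congrArg (g⁻¹ : E ≃ₗᵢ[ℝ] E) ih).symm.trans (g.symm_apply_apply x)

/-- A reflection group is determined by its permutation action on the roots. -/
theorem IsRootSystem.finite_reflectionGroup [FiniteDimensional ℝ E] {Φ : Set E}
    (hΦ : IsRootSystem Φ) : Finite (reflectionGroup Φ) := by
  have := hΦ.finite.to_subtype
  let perm : reflectionGroup Φ → Φ → Φ := fun g β =>
    ⟨(g : E ≃ₗᵢ[ℝ] E) β, hΦ.mem_of_mem_reflectionGroup g.2 β β.2⟩
  refine Finite.of_injective perm fun g h hgh => Subtype.ext (LinearIsometryEquiv.ext fun x => ?_)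
  obtain ⟨y, hy, z, hz, rfl⟩ := (Submodule.span ℝ Φ).exists_add_mem_mem_orthogonal x
  have hspan : Set.EqOn (g : E ≃ₗᵢ[ℝ] E).toLinearEquiv.toLinearMap
      (h : E ≃ₗᵢ[ℝ] E).toLinearEquiv.toLinearMap Φ := fun β hβ =>
    congrArg Subtype.val (congrFun hgh ⟨β, hβ⟩)
  rw [map_add, map_add, apply_eq_of_mem_reflectionGroup g.2 hz,
    apply_eq_of_mem_reflectionGroup h.2 hz]
  exact congrArg (· + z) (LinearMap.eqOn_span hspan hy)

end Finite

end

end Coinv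

theorem mainTheorem3 {E : Type*} [NormedAddCommGroup E] [InnerProductSpace ℝ E]
    [FiniteDimensional ℝ E] (Φ Δ Θ : Set E) (hΦ : Coinv.IsRootSystem Φ)
    (hΔ : Coinv.IsSimpleSystem Φ Δ) (hΘ : Θ ⊆ Δ) :
    let W : Subgroup (E ≃ₗᵢ[ℝ] E) := Coinv.reflectionGroup Φ
    let WΘ : Subgroup (E ≃ₗᵢ[ℝ] E) := Coinv.reflectionGroup Θ
    let hle : WΘ ≤ W := Coinv.reflectionGroup_mono (hΘ.trans hΔ.subset)
    let A : Subalgebra ℝ (Coinv.CoinvariantRing W) := Coinv.relCoinvariants hle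
    (Module.Free A (Coinv.CoinvariantRing W) ∧
      Module.Finite A (Coinv.CoinvariantRing W) ∧
      Module.finrank A (Coinv.CoinvariantRing W) = Nat.card WΘ ∧
      Nat.card WΘ = Module.finrank ℝ (Coinv.CoinvariantRing WΘ)) ∧
    (Function.Surjective (Coinv.coinvariantMap hle) ∧
      RingHom.ker (Coinv.coinvariantMap hle) =
        (Coinv.positiveIdeal (Coinv.coinvariantDegree W) A).map A.val) := by
  intro W WΘ hle A
  have hW : Finite W := hΦ.finite_reflectionGroup
  have hWΘ : Finite WΘ := Finite.of_injective _ (Subgroup.inclusion_injective hle)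
  have := Fintype.ofFinite WΘ
  have hΘ0 : (0 : E) ∉ Θ := fun h => hΦ.zero_notMem (hΔ.subset (hΘ h))
  obtain ⟨I, ⟨bq⟩, ⟨b⟩⟩ := Coinv.exists_basis_invariants hΘ0 (G := WΘ) rfl
  have hI : Nat.card I = Nat.card WΘ := Coinv.card_eq_of_basis b
  have hIfin : Finite I := Nat.finite_of_card_ne_zero (hI ▸ Nat.card_pos.ne')
  obtain ⟨bA⟩ := Coinv.nonempty_basis_relCoinvariants hle b
  have hfin : Module.finrank ℝ (Coinv.CoinvariantRing WΘ) = Nat.card WΘ := by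
    rw [← hI, Module.finrank_eq_nat_card_basis bq]
  -- The rank over `A` is only meaningful if the coinvariant ring of `W` is nonzero.
  have : Nontrivial (Coinv.CoinvariantRing WΘ) :=
    Module.nontrivial_of_finrank_pos (R := ℝ) (hfin ▸ Nat.card_pos)
  have : Nontrivial (Coinv.CoinvariantRing W) := (Coinv.coinvariantMap_surjective hle).nontrivial
  refine ⟨⟨.of_basis bA, .of_basis bA, ?_, ?_⟩, Coinv.coinvariantMap_surjective hle,
    Coinv.ker_coinvariantMap hle⟩
  · rw [Module.finrank_eq_nat_card_basis bA, hI]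
  · exact hfin.symm
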